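/- For a compact metric space $(X,d)$ let $X^{(1)}$ be the set of orbits of points of $X$ under the group of all isometries of $X$ onto $X$, equipped with the greatest pseudometric $d^{(1)}$ for which the canonical projection $X\to X^{(1)}$ is nonexpansive; $(X^{(1)},d^{(1)})$ is again a compact metric space. Put $X^{(0)}=X$ and $X^{(n)}=(X^{(n-1)})^{(1)}$ for $n\ge 1$. The space $X$ is called quasi-nilpotent if $\lim_{n\to\infty}\operatorname{diam}(X^{(n)})=0$. For a nonempty compact metric space $X$ let $\operatorname{Prob}(X)$ be the set of Borel probability measures on $X$, equipped with the Kantorovich metric $$\widehat d(\mu,\nu)=\sup\Bigl\{\Bigl|\int_X f\,d\mu-\int_X f\,d\nu\Bigr| : f\colon X\to\mathbb R \text{ is } 1\text{-Lipschitz}\Bigr\}.$$ For a convex set $K\subset\operatorname{Prob}(X)$ let $\operatorname{Fix}(K)$ be the set of all points of $K$ fixed by every affine isometry of $K$ onto $K$. Put $\operatorname{Fix}^0(K)=K$, $\operatorname{Fix}^n(K)=\operatorname{Fix}(\operatorname{Fix}^{n-1}(K))$ for $n\ge 1$, and $\Delta(X)=\bigcap_{n\ge 0}\operatorname{Fix}^n(\operatorname{Prob}(X))$.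 If $X$ is quasi-nilpotent and $\Delta(X)$ consists of a single measure, this measure is denoted by $\lambda_X$ and called the central measure of $X$ of the second kind. **Proposition.** The interval $[0,1]$ (with its usual metric) is quasi-nilpotent, $\Delta([0,1])$ consists of exactly one measure, and this measure $\lambda_{[0,1]}$ is the Lebesgue measure on $[0,1]$. -/

import Mathlib

open MeasureTheory Set Filter Topology

noncomputable section

/-! ### The orbit space of a compact metric space -/

/-- Two points of a metric space are equivalent if some isometry of the space onto itself
sends one to the other. -/
def isoSetoid (X : Type*) [MetricSpace X] : Setoid X where
  r x y := ∃ g : X ≃ᵢ X, g x = y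
  iseqv :=
    { refl := fun x => ⟨IsometryEquiv.refl X, rfl⟩
      symm := by
        rintro x _ ⟨g, rfl⟩
        exact ⟨g.symm, g.symm_apply_apply x⟩
      trans := by
        rintro x _ _ ⟨g, rfl⟩ ⟨h, rfl⟩
        exact ⟨g.trans h, rfl⟩ }

/-- The set of orbits of the points of `X` under the full isometry group of `X`. -/
def OrbitSpace (X : Type*) [MetricSpace X] : Type _ := Quotient (isoSetoid X)

namespace OrbitSpace

variable {X : Type*} [MetricSpace X]

/-- The canonical projection of `X` onto its orbit space. -/
def proj (x : X) : OrbitSpace X := Quotient.mk (isoSetoid X) x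

theorem proj_surjective : Function.Surjective (proj : X → OrbitSpace X) := Quotient.mk_surjective

theorem proj_eq_iff {x y : X} : proj x = proj y ↔ ∃ g : X ≃ᵢ X, g x = y := by
  constructor
  · exact fun h => Quotient.exact h
  · exact fun h => Quotient.sound h

/-- `p` is a pseudometric on the orbit space that makes the canonical projection nonexpansive. -/
structure IsAdmissible (p : OrbitSpace X → OrbitSpace X → ℝ) : Prop where
  self : ∀ a, p a a = 0
  symm : ∀ a b, p a b = p b a
  triangle : ∀ a b c, p a c ≤ p a b + p b c
  nonneg : ∀ a b, 0 ≤ p a b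
  nonexpansive : ∀ x y : X, p (proj x) (proj y) ≤ dist x y

/-- The pointwise supremum of all pseudometrics on the orbit space that make the canonical
projection nonexpansive; `isAdmissible_gdist` and `le_gdist` show that it is the greatest of
them. -/
def gdist (a b : OrbitSpace X) : ℝ :=
  sSup {r : ℝ | ∃ p : OrbitSpace X → OrbitSpace X → ℝ, IsAdmissible p ∧ r = p a b}

theorem isAdmissible_zero : IsAdmissible (fun _ _ : OrbitSpace X => (0 : ℝ)) :=
  ⟨by simp, by simp, by simp, by simp, fun x y => dist_nonneg⟩

theorem le_gdist {p : OrbitSpace X → OrbitSpace X → ℝ} (hp : IsAdmissible p)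
    (a b : OrbitSpace X) : p a b ≤ gdist a b := by
  obtain ⟨x, rfl⟩ := proj_surjective a
  obtain ⟨y, rfl⟩ := proj_surjective b
  refine le_csSup ⟨dist x y, ?_⟩ ⟨p, hp, rfl⟩
  rintro _ ⟨q, hq, rfl⟩
  exact hq.nonexpansive x y

theorem gdist_le {a b : OrbitSpace X} {r : ℝ}
    (h : ∀ p : OrbitSpace X → OrbitSpace X → ℝ, IsAdmissible p → p a b ≤ r) :
    gdist a b ≤ r := by
  refine csSup_le ⟨0, _, isAdmissible_zero, rfl⟩ ?_
  rintro _ ⟨p, hp, rfl⟩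
  exact h p hp

theorem isAdmissible_gdist : IsAdmissible (gdist : OrbitSpace X → OrbitSpace X → ℝ) where
  self a := le_antisymm (gdist_le fun _ hp => (hp.self a).le) (le_gdist isAdmissible_zero a a)
  symm a b := le_antisymm (gdist_le fun _ hp => hp.symm a b ▸ le_gdist hp b a)
    (gdist_le fun _ hp => hp.symm b a ▸ le_gdist hp a b)
  triangle a b c := gdist_le fun _ hp =>
    (hp.triangle a b c).trans (add_le_add (le_gdist hp a b) (le_gdist hp b c))
  nonneg a b := le_gdist isAdmissible_zero a b
  nonexpansive x y := gdist_le fun _ hp => hp.nonexpansive x y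

/-- The distance between two orbits, as an infimum. It is an admissible pseudometric. -/
theorem exists_isAdmissible_iInf :
    ∃ p : OrbitSpace X → OrbitSpace X → ℝ, IsAdmissible p ∧
      ∀ x y : X, p (proj x) (proj y) = ⨅ g : X ≃ᵢ X, dist x (g y) := by
  have bdd : ∀ x y : X, BddBelow (range fun g : X ≃ᵢ X => dist x (g y)) := fun x y =>
    ⟨0, by rintro _ ⟨g, rfl⟩; exact dist_nonneg⟩
  have hl : ∀ (x y : X) (k : X ≃ᵢ X),
      ⨅ g : X ≃ᵢ X, dist (k x) (g y) ≤ ⨅ g : X ≃ᵢ X, dist x (g y) := by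
    intro x y k
    refine le_ciInf fun g => (ciInf_le (bdd _ _) (g.trans k)).trans (le_of_eq ?_)
    exact k.dist_eq x (g y)
  have hr : ∀ (x y : X) (k : X ≃ᵢ X),
      ⨅ g : X ≃ᵢ X, dist x (g (k y)) ≤ ⨅ g : X ≃ᵢ X, dist x (g y) := by
    intro x y k
    refine le_ciInf fun g => (ciInf_le (bdd _ _) (k.symm.trans g)).trans (le_of_eq ?_)
    simp
  have hlr : ∀ x x' : X, (isoSetoid X).r x x' → ∀ y y' : X, (isoSetoid X).r y y' →
      ⨅ g : X ≃ᵢ X, dist x' (g y') ≤ ⨅ g : X ≃ᵢ X, dist x (g y) := by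
    rintro x _ ⟨k, rfl⟩ y _ ⟨l, rfl⟩
    exact (hl x _ k).trans (hr x y l)
  refine ⟨fun a b => Quotient.liftOn₂' a b (fun x y => ⨅ g : X ≃ᵢ X, dist x (g y)) ?_,
    ⟨?_, ?_, ?_, ?_, ?_⟩, fun x y => rfl⟩
  · intro x y x' y' h h'
    exact le_antisymm (hlr _ _ ((isoSetoid X).symm h) _ _ ((isoSetoid X).symm h'))
      (hlr _ _ h _ _ h')
  · intro a
    obtain ⟨x, rfl⟩ := proj_surjective a
    refine le_antisymm ((ciInf_le (bdd x x) (IsometryEquiv.refl X)).trans ?_)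
      (le_ciInf fun g => dist_nonneg)
    exact (dist_self x).le
  · have : ∀ x y : X, ⨅ g : X ≃ᵢ X, dist x (g y) ≤ ⨅ g : X ≃ᵢ X, dist y (g x) := by
      intro x y
      refine le_ciInf fun g => (ciInf_le (bdd _ _) g.symm).trans (le_of_eq ?_)
      rw [← g.dist_eq, dist_comm]
      simp
    intro a b
    obtain ⟨x, rfl⟩ := proj_surjective a
    obtain ⟨y, rfl⟩ := proj_surjective b
    exact le_antisymm (this x y) (this y x)
  · intro a b c
    obtain ⟨x, rfl⟩ := proj_surjective a
    obtain ⟨y, rfl⟩ := proj_surjective b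
    obtain ⟨z, rfl⟩ := proj_surjective c
    change ⨅ g : X ≃ᵢ X, dist x (g z) ≤
      (⨅ g : X ≃ᵢ X, dist x (g y)) + ⨅ g : X ≃ᵢ X, dist y (g z)
    rw [← sub_le_iff_le_add]
    refine le_ciInf fun g => ?_
    rw [sub_le_iff_le_add, ← sub_le_iff_le_add']
    refine le_ciInf fun h => ?_
    rw [sub_le_iff_le_add']
    refine (ciInf_le (bdd _ _) (h.trans g)).trans ((dist_triangle x (g y) _).trans ?_)
    exact add_le_add le_rfl (g.dist_eq y (h z)).le
  · intro a b
    obtain ⟨x, rfl⟩ := proj_surjective a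
    obtain ⟨y, rfl⟩ := proj_surjective b
    exact le_ciInf fun g => dist_nonneg
  · intro x y
    exact ciInf_le (bdd x y) (IsometryEquiv.refl X)

theorem gdist_proj (x y : X) :
    gdist (proj x) (proj y) = ⨅ g : X ≃ᵢ X, dist x (g y) := by
  obtain ⟨p, hp, hpe⟩ := exists_isAdmissible_iInf (X := X)
  refine le_antisymm (le_ciInf fun g => ?_) ((hpe x y).symm ▸ le_gdist hp _ _)
  have : proj y = proj (g y) := proj_eq_iff.2 ⟨g, rfl⟩
  rw [this]
  exact isAdmissible_gdist.nonexpansive x (g y)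

/-- On a compact space the greatest pseudometric is a metric. -/
theorem eq_of_gdist_eq_zero [CompactSpace X] {a b : OrbitSpace X} (h : gdist a b = 0) :
    a = b := by
  obtain ⟨x, rfl⟩ := proj_surjective a
  obtain ⟨y, rfl⟩ := proj_surjective b
  rw [gdist_proj] at h
  have hex : ∀ n : ℕ, ∃ g : X ≃ᵢ X, dist x (g y) < 1 / ((n : ℝ) + 1) := fun n =>
    exists_lt_of_ciInf_lt (by rw [h]; positivity)
  choose g hg using hex
  let U : Ultrafilter ℕ := Ultrafilter.of atTop
  have hU : (U : Filter ℕ) ≤ atTop := Ultrafilter.of_le atTop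
  have hlim : ∀ u : ℕ → X, ∃ z, Tendsto u U (𝓝 z) := fun u =>
    ⟨_, (U.map u).le_nhds_lim⟩
  choose F hF using fun z : X => hlim fun n => g n z
  choose G hG using fun z : X => hlim fun n => (g n).symm z
  have hFd : ∀ z w, dist (F z) (F w) = dist z w := fun z w => by
    have h1 := (hF z).dist (hF w)
    simp only [IsometryEquiv.dist_eq] at h1
    exact tendsto_nhds_unique h1 tendsto_const_nhds |>.symm ▸ rfl
  have hFG : ∀ z, F (G z) = z := fun z => by
    have h1 : Tendsto (fun n => dist (g n (G z)) z) U (𝓝 (dist (F (G z)) z)) :=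
      (hF (G z)).dist tendsto_const_nhds
    have h2 : Tendsto (fun n => dist (G z) ((g n).symm z)) U (𝓝 (dist (G z) (G z))) :=
      tendsto_const_nhds.dist (hG z)
    have h3 : ∀ n, dist (g n (G z)) z = dist (G z) ((g n).symm z) := fun n => by
      rw [← (g n).dist_eq (G z)]
      simp
    simp only [h3] at h1
    have := tendsto_nhds_unique h1 h2
    rwa [dist_self, dist_eq_zero] at this
  have hFi : Isometry F := Isometry.of_dist_eq hFd
  let Φ : X ≃ᵢ X := IsometryEquiv.mk' F G hFG hFi
  have hxy : F y = x := by
    have h1 : Tendsto (fun n => dist x (g n y)) U (𝓝 (dist x (F y))) :=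
      tendsto_const_nhds.dist (hF y)
    have h2 : Tendsto (fun n => dist x (g n y)) U (𝓝 0) :=
      (squeeze_zero (fun n => dist_nonneg) (fun n => (hg n).le)
        tendsto_one_div_add_atTop_nhds_zero_nat).mono_left hU
    have := tendsto_nhds_unique h1 h2
    rw [dist_eq_zero] at this
    exact this.symm
  exact (proj_eq_iff.2 ⟨Φ, hxy⟩).symm

/-- The orbit space of a compact metric space, with the greatest pseudometric for which the
canonical projection is nonexpansive. -/
instance instMetricSpace [CompactSpace X] : MetricSpace (OrbitSpace X) where
  dist := gdist
  dist_self := isAdmissible_gdist.self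
  dist_comm := isAdmissible_gdist.symm
  dist_triangle := isAdmissible_gdist.triangle
  eq_of_dist_eq_zero := eq_of_gdist_eq_zero

theorem dist_def [CompactSpace X] (a b : OrbitSpace X) : dist a b = gdist a b := rfl

instance instCompactSpace [CompactSpace X] : CompactSpace (OrbitSpace X) := by
  have hc : Continuous (proj : X → OrbitSpace X) :=
    (LipschitzWith.mk_one fun x y => isAdmissible_gdist.nonexpansive x y).continuous
  exact ⟨by rw [← proj_surjective.range_eq]; exact isCompact_range hc⟩

end OrbitSpace

/-- A bundled compact metric space. -/
structure CompactMetric where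
  carrier : Type
  [metric : MetricSpace carrier]
  [compact : CompactSpace carrier]

attribute [instance] CompactMetric.metric CompactMetric.compact

/-- The compact metric space of orbits of a compact metric space. -/
def CompactMetric.orbit (X : CompactMetric) : CompactMetric := ⟨OrbitSpace X.carrier⟩

/-- `X` is quasi-nilpotent if the diameters of the iterated orbit spaces tend to `0`. -/
def QuasiNilpotent (X : Type) [MetricSpace X] [CompactSpace X] : Prop :=
  Tendsto (fun n : ℕ => Metric.diam (univ : Set (CompactMetric.orbit^[n] ⟨X⟩).carrier))
    atTop (𝓝 0)

/-! ### Probability measures -/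

section Prob

variable {X : Type*} [MetricSpace X] [MeasurableSpace X]

/-- The Kantorovich distance of two Borel probability measures on a compact metric space. -/
def kantorovichDist (μ ν : ProbabilityMeasure X) : ℝ :=
  sSup {r : ℝ | ∃ f : X → ℝ, LipschitzWith 1 f ∧
    r = |(∫ x, f x ∂(μ : Measure X)) - ∫ x, f x ∂(ν : Measure X)|}

/-- `κ` is the convex combination `t μ + (1 - t) ν`. -/
def IsConvexComb (t : ℝ) (μ ν κ : ProbabilityMeasure X) : Prop :=
  (κ : Measure X) =
    ENNReal.ofReal t • (μ : Measure X) + ENNReal.ofReal (1 - t) • (ν : Measure X)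

/-- `Φ` is an affine isometry, for the Kantorovich metric, of the set `K` of probability
measures onto itself. -/
structure IsAffineIsometry (K : Set (ProbabilityMeasure X)) (Φ : K → K) : Prop where
  surjective : Function.Surjective Φ
  isometry : ∀ μ ν : K, kantorovichDist (Φ μ).1 (Φ ν).1 = kantorovichDist μ.1 ν.1
  affine : ∀ t ∈ Icc (0 : ℝ) 1, ∀ μ ν κ : K,
    IsConvexComb t μ.1 ν.1 κ.1 → IsConvexComb t (Φ μ).1 (Φ ν).1 (Φ κ).1

/-- The set of common fixed points of all affine isometries of `K` onto `K`. -/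
def fixSet (K : Set (ProbabilityMeasure X)) : Set (ProbabilityMeasure X) :=
  {μ | ∃ h : μ ∈ K, ∀ Φ : K → K, IsAffineIsometry K Φ → Φ ⟨μ, h⟩ = ⟨μ, h⟩}

variable (X) in
/-- The set `Δ(X)`: the intersection of the iterated fixed point sets, starting with the set of
all Borel probability measures on `X`. When it has exactly one element (equivalently, when `X`
is nonempty and quasi-nilpotent), this element is the central measure of `X` of the second
kind. -/
def deltaSet [CompactSpace X] [BorelSpace X] : Set (ProbabilityMeasure X) :=
  ⋂ n : ℕ, fixSet^[n] univ

end Prob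

end

noncomputable section

/-! ### Isometries and folding of the unit interval -/

namespace unitInterval

/-! Both halves of the statement rest on the tent map `fold`. The only isometries of an interval are
the identity and the reflection `σ`, so the orbits are the fibres of `fold`, and the orbit space is
an interval of half the length. Iteration gives diameters at most 2⁻ⁿ.

For measures, let U be `unfoldProb`, the average of the push-forwards along the two inverse branches
of `fold`. An affine isometry of Prob([0,1]) preserves extreme points, which are the Dirac masses,
and so acts on the points by the identity or by `σ`. The distance from μ to a Dirac mass is the mean
distance to its point, and these mean distances determine μ. Hence the isometry is the identity or
`reflect`, and Fix(Prob) is the set of symmetric measures, which is the range of U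
(`fixSet_univ_eq_range_unfoldProb`).

U is affine and multiplies the Kantorovich distance by exactly 1/2 (`kantorovichDist_unfoldProb`),
so conjugation by U gives Fix(U(K)) = U(Fix(K)) and Fixⁿ(Prob) is the range of Uⁿ
(`iterate_fixSet_univ`). These ranges have diameter at most 2 · 2⁻ⁿ and all contain Lebesgue
measure, which U fixes. -/

theorem dist_coe (x y : unitInterval) : dist x y = |(x : ℝ) - y| := rfl

theorem dist_symm_symm (x y : unitInterval) : dist (σ x) (σ y) = dist x y := by
  simp only [dist_coe, coe_symm_eq]
  rw [← abs_neg]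
  congr 1
  ring

/-- A distance preserving self-map of the unit interval is the identity or the reflection. -/
theorem eq_id_or_eq_symm_of_dist_eq {g : unitInterval → unitInterval}
    (hg : ∀ x y, dist (g x) (g y) = dist x y) : (∀ x, g x = x) ∨ ∀ x, g x = σ x := by
  have h01 := hg 0 1
  simp only [dist_coe] at h01 hg
  have b0 := (g 0).2
  have b1 := (g 1).2
  simp only [mem_Icc, Icc.coe_zero, Icc.coe_one] at h01 b0 b1
  -- Two points of the interval at distance 1 are its endpoints. Once `g 0` is an endpoint, the
  -- distance of `g x` to it determines `g x`.
  have hcase : ((g 0 : ℝ) = 0) ∨ ((g 0 : ℝ) = 1) := by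
    rcases abs_cases ((g 0 : ℝ) - g 1) with h | h <;> norm_num at h01 <;>
      [right; left] <;> linarith
  rcases hcase with h | h
  · left
    intro x
    have := hg x 0
    rw [h, Icc.coe_zero, sub_zero, sub_zero, abs_of_nonneg (g x).2.1, abs_of_nonneg x.2.1] at this
    exact Subtype.ext this
  · right
    intro x
    have := hg x 0
    rw [h, Icc.coe_zero, sub_zero, abs_of_nonneg x.2.1,
      abs_of_nonpos (by linarith [(g x).2.2])] at this
    refine Subtype.ext ?_
    rw [coe_symm_eq]
    linarith

/-- The contraction `x ↦ x / 2`. -/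
def half (x : unitInterval) : unitInterval :=
  ⟨x / 2, by have := x.2.1; positivity, by linarith [x.2.2]⟩

/-- The tent map, which folds the interval onto itself. -/
def fold (x : unitInterval) : unitInterval :=
  ⟨1 - |1 - 2 * (x : ℝ)|, by
    have h : |1 - 2 * (x : ℝ)| ≤ 1 := abs_le.2 ⟨by linarith [x.2.2], by linarith [x.2.1]⟩
    linarith, by linarith [abs_nonneg (1 - 2 * (x : ℝ))]⟩

theorem coe_half (x : unitInterval) : (half x : ℝ) = x / 2 := rfl

theorem coe_fold (x : unitInterval) : (fold x : ℝ) = 1 - |1 - 2 * (x : ℝ)| := rfl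

theorem fold_half (x : unitInterval) : fold (half x) = x := by
  refine Subtype.ext ?_
  rw [coe_fold, coe_half, abs_of_nonneg] <;> linarith [x.2.2]

theorem fold_symm (x : unitInterval) : fold (σ x) = fold x := by
  refine Subtype.ext ?_
  rw [coe_fold, coe_fold, coe_symm_eq, ← abs_neg]
  congr 2
  ring

/-- `half` is the section of `fold` that selects the point of [0, 1/2] in the orbit {x, σ x}. -/
theorem half_fold (x : unitInterval) : half (fold x) = x ∨ half (fold x) = σ x := by
  rcases abs_cases (1 - 2 * (x : ℝ)) with h | h
  · left
    refine Subtype.ext ?_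
    rw [coe_half, coe_fold, h.1]
    ring
  · right
    refine Subtype.ext ?_
    rw [coe_half, coe_fold, coe_symm_eq, h.1]
    ring

theorem dist_half (x y : unitInterval) : dist (half x) (half y) = dist x y / 2 := by
  rw [dist_coe, dist_coe, coe_half, coe_half, ← sub_div, abs_div, abs_two]

theorem dist_fold_le (x y : unitInterval) : dist (fold x) (fold y) ≤ 2 * dist x y := by
  rw [dist_coe, dist_coe, coe_fold, coe_fold]
  have h := abs_abs_sub_abs_le_abs_sub (1 - 2 * (y : ℝ)) (1 - 2 * (x : ℝ))
  have e : (1 - 2 * (y : ℝ)) - (1 - 2 * (x : ℝ)) = 2 * (x - y) := by ring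
  rw [e, abs_mul, abs_two] at h
  rwa [sub_sub_sub_cancel_left]

theorem fold_eq_fold_iff {x y : unitInterval} : fold x = fold y ↔ x = y ∨ x = σ y := by
  constructor
  · intro h
    rcases half_fold x with hx | hx <;> rcases half_fold y with hy | hy <;> rw [h, hy] at hx
    · exact .inl hx.symm
    · exact .inr hx.symm
    · exact .inr (by rw [hx, symm_symm])
    · exact .inl (symm_involutive.injective hx).symm
  · rintro (rfl | rfl)
    · rfl
    · exact fold_symm y

theorem continuous_half : Continuous half :=
  (continuous_subtype_val.div_const 2).subtype_mk _

theorem continuous_fold : Continuous fold :=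
  (by fun_prop : Continuous fun x : unitInterval => 1 - |1 - 2 * (x : ℝ)|).subtype_mk _

end unitInterval

/-! ### Quasi-nilpotency of the unit interval -/

open unitInterval

/-- `X` is similar to the unit interval, with ratio `c`. -/
def IsScaledInterval (c : ℝ) (X : CompactMetric) : Prop :=
  ∃ e : X.carrier ≃ unitInterval, ∀ x y, dist x y = c * dist (e x) (e y)

theorem IsScaledInterval.diam {c : ℝ} (hc : 0 < c) {X : CompactMetric}
    (h : IsScaledInterval c X) : Metric.diam (univ : Set X.carrier) ≤ c := by
  obtain ⟨e, he⟩ := h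
  refine Metric.diam_le_of_forall_dist_le hc.le fun x _ y _ => ?_
  rw [he]
  refine mul_le_of_le_one_right hc.le ?_
  rw [dist_coe, abs_le]
  constructor <;> linarith [(e x).2.1, (e x).2.2, (e y).2.1, (e y).2.2]

/-- The orbits are the fibres of `fold ∘ e`, so this map induces the bijection `F`. Representatives
in the lower half bound the orbit distance from above. Since `fold` is 2-Lipschitz, the scaled
distance of the images under `F` is an admissible pseudometric, which gives the lower bound. -/
theorem IsScaledInterval.orbit {c : ℝ} (hc : 0 < c) {X : CompactMetric}
    (h : IsScaledInterval c X) : IsScaledInterval (c / 2) X.orbit := by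
  obtain ⟨e, he⟩ := h
  have hiso : ∀ g : X.carrier ≃ᵢ X.carrier, (∀ x, g x = x) ∨ ∀ x, g x = e.symm (σ (e x)) := by
    intro g
    have := eq_id_or_eq_symm_of_dist_eq (g := fun t => e (g (e.symm t))) fun s t => by
      have h1 := g.dist_eq (e.symm s) (e.symm t)
      rw [he, he, e.apply_symm_apply, e.apply_symm_apply] at h1
      exact mul_left_cancel₀ hc.ne' h1
    refine this.imp (fun h x => ?_) fun h x => ?_
    · simpa using h (e x)
    · have := h (e x)
      simp only [e.symm_apply_apply] at this
      rw [← this, e.symm_apply_apply]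
  let ρ : X.carrier ≃ᵢ X.carrier := IsometryEquiv.mk' (fun x => e.symm (σ (e x)))
    (fun x => e.symm (σ (e x))) (fun x => by simp) (Isometry.of_dist_eq fun x y => by
      rw [he, he]; simp [dist_symm_symm])
  have hρ : ∀ x, ρ x = e.symm (σ (e x)) := fun x => rfl
  have hfold : ∀ x y : X.carrier,
      OrbitSpace.proj x = OrbitSpace.proj y ↔ fold (e x) = fold (e y) := by
    intro x y
    rw [OrbitSpace.proj_eq_iff, fold_eq_fold_iff]
    constructor
    · rintro ⟨g, rfl⟩
      rcases hiso g with h | h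
      · exact .inl (by rw [h])
      · exact .inr (by rw [h]; simp)
    · rintro (h | h)
      · exact ⟨IsometryEquiv.refl _, e.injective h⟩
      · exact ⟨ρ, by rw [hρ, h]; simp⟩
  let F : OrbitSpace X.carrier → unitInterval := fun a =>
    Quotient.liftOn' a (fun x => fold (e x)) fun x y h => (hfold x y).1 (Quotient.sound h)
  have hF : ∀ x, F (OrbitSpace.proj x) = fold (e x) := fun x => rfl
  have hFb : Function.Bijective F := by
    constructor
    · intro a b hab
      obtain ⟨x, rfl⟩ := OrbitSpace.proj_surjective a
      obtain ⟨y, rfl⟩ := OrbitSpace.proj_surjective b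
      exact (hfold x y).2 hab
    · intro t
      exact ⟨OrbitSpace.proj (e.symm (half t)), by rw [hF, e.apply_symm_apply, fold_half]⟩
  refine ⟨Equiv.ofBijective F hFb, fun a b => ?_⟩
  have hrep : ∀ a, a = OrbitSpace.proj (e.symm (half (F a))) := fun a =>
    hFb.1 (by rw [hF, e.apply_symm_apply, fold_half])
  change OrbitSpace.gdist a b = c / 2 * dist (F a) (F b)
  refine le_antisymm ?_ ?_
  · conv_lhs => rw [hrep a, hrep b]
    refine (OrbitSpace.isAdmissible_gdist.nonexpansive _ _).trans (le_of_eq ?_)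
    rw [he, e.apply_symm_apply, e.apply_symm_apply, dist_half]
    ring
  · refine OrbitSpace.le_gdist (p := fun a b => c / 2 * dist (F a) (F b))
      ⟨by simp, fun a b => by rw [dist_comm], fun a b d => ?_, fun a b => by positivity,
        fun x y => ?_⟩ a b
    · rw [← mul_add]
      exact mul_le_mul_of_nonneg_left (dist_triangle _ _ _) (by positivity)
    · rw [hF, hF, he]
      nlinarith [dist_fold_le (e x) (e y)]

theorem quasiNilpotent_unitInterval : QuasiNilpotent unitInterval := by
  have h : ∀ n : ℕ, IsScaledInterval ((1 / 2) ^ n) (CompactMetric.orbit^[n] ⟨unitInterval⟩) := by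
    intro n
    induction n with
    | zero => exact ⟨Equiv.refl _, fun x y => by rw [pow_zero, one_mul]; rfl⟩
    | succ n ih =>
      rw [Function.iterate_succ_apply', pow_succ, mul_one_div]
      exact ih.orbit (by positivity)
  exact squeeze_zero (fun _ => Metric.diam_nonneg) (fun n => (h n).diam (by positivity))
    (tendsto_pow_atTop_nhds_zero_of_lt_one (by norm_num) (by norm_num))

/-! ### The Kantorovich distance on the unit interval -/

section Kantorovich

variable {μ ν : ProbabilityMeasure unitInterval}

theorem unitInterval.integrable_of_continuous {f : unitInterval → ℝ} (hf : Continuous f)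
    (m : Measure unitInterval) [IsFiniteMeasure m] : Integrable f m :=
  hf.integrable_of_hasCompactSupport (HasCompactSupport.of_compactSpace f)

theorem unitInterval.dist_le_one (x y : unitInterval) : dist x y ≤ 1 := by
  rw [dist_coe, abs_le]
  constructor <;> linarith [x.2.1, x.2.2, y.2.1, y.2.2]

theorem abs_integral_sub_le {f : unitInterval → ℝ} (hf : LipschitzWith 1 f)
    (m : ProbabilityMeasure unitInterval) (x : unitInterval) :
    |(∫ y, f y ∂(m : Measure unitInterval)) - f x| ≤
      ∫ y, dist y x ∂(m : Measure unitInterval) := by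
  have h : (∫ y, f y ∂(m : Measure unitInterval)) - f x =
      ∫ y, (f y - f x) ∂(m : Measure unitInterval) := by
    rw [integral_sub (integrable_of_continuous hf.continuous _) (integrable_const _)]
    simp
  rw [h]
  refine (abs_integral_le_integral_abs).trans (integral_mono
    (integrable_of_continuous (by have := hf.continuous; fun_prop) _)
    (integrable_of_continuous (by fun_prop) _) fun y => ?_)
  simpa [Real.dist_eq] using hf.dist_le_mul y x

/-- Each integral is within 1 of `f 0`. The crude constant 2 suffices to make the supremum defining
`kantorovichDist` finite and to bound the diameter of Prob([0,1]). -/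
theorem abs_integral_sub_integral_le_two {f : unitInterval → ℝ} (hf : LipschitzWith 1 f) :
    |(∫ x, f x ∂(μ : Measure unitInterval)) - ∫ x, f x ∂(ν : Measure unitInterval)| ≤ 2 := by
  have h : ∀ m : ProbabilityMeasure unitInterval,
      |(∫ y, f y ∂(m : Measure unitInterval)) - f 0| ≤ 1 := fun m =>
    (abs_integral_sub_le hf m 0).trans <| (integral_mono (integrable_of_continuous (by fun_prop) _)
      (integrable_const (1 : ℝ)) fun y => dist_le_one y 0).trans (by simp)
  have h1 := abs_le.1 (h μ)
  have h2 := abs_le.1 (h ν)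
  rw [abs_le]
  constructor <;> linarith

theorem le_kantorovichDist {f : unitInterval → ℝ} (hf : LipschitzWith 1 f) :
    |(∫ x, f x ∂(μ : Measure unitInterval)) - ∫ x, f x ∂(ν : Measure unitInterval)| ≤
      kantorovichDist μ ν :=
  le_csSup ⟨2, by rintro _ ⟨f, hf, rfl⟩; exact abs_integral_sub_integral_le_two hf⟩ ⟨f, hf, rfl⟩

theorem kantorovichDist_le {r : ℝ} (h : ∀ f : unitInterval → ℝ, LipschitzWith 1 f →
    |(∫ x, f x ∂(μ : Measure unitInterval)) - ∫ x, f x ∂(ν : Measure unitInterval)| ≤ r) :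
    kantorovichDist μ ν ≤ r := by
  refine csSup_le ⟨_, fun _ => 0, LipschitzWith.const' 0, rfl⟩ ?_
  rintro _ ⟨f, hf, rfl⟩
  exact h f hf

theorem kantorovichDist_self (μ : ProbabilityMeasure unitInterval) : kantorovichDist μ μ = 0 :=
  le_antisymm (kantorovichDist_le fun f hf => by simp)
    ((abs_nonneg _).trans (le_kantorovichDist (LipschitzWith.const' 0)))

/-- The Dirac mass at a point. -/
def diracProb (x : unitInterval) : ProbabilityMeasure unitInterval := ⟨Measure.dirac x, inferInstance⟩

/-- The function `dist · x` is extremal, because |f y - f x| ≤ dist y x for every 1-Lipschitz f. -/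
theorem kantorovichDist_diracProb (μ : ProbabilityMeasure unitInterval) (x : unitInterval) :
    kantorovichDist μ (diracProb x) = ∫ y, dist y x ∂(μ : Measure unitInterval) := by
  refine le_antisymm (kantorovichDist_le fun f hf => ?_) ?_
  · simpa [diracProb] using abs_integral_sub_le hf μ x
  · refine le_trans (le_of_eq ?_)
      (le_kantorovichDist (f := fun y => dist y x) (LipschitzWith.dist_left x))
    simp only [diracProb, ProbabilityMeasure.coe_mk, integral_dirac, dist_self, sub_zero]
    exact (abs_of_nonneg (integral_nonneg fun y => dist_nonneg)).symm

/-- The function equal to `1` on `[0, c]`, to `0` on `[c + 1 / n, 1]`, and affine in between. -/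
def ramp (c : ℝ) (n : ℕ) (y : ℝ) : ℝ := (n : ℝ) / 2 * (|y - (c + 1 / n)| - |y - c|) + 1 / 2

theorem abs_ramp_le (c : ℝ) (n : ℕ) (y : ℝ) : |ramp c n y| ≤ 1 := by
  rcases n.eq_zero_or_pos with rfl | hn
  · norm_num [ramp]
  have hn' : (0 : ℝ) < n := by exact_mod_cast hn
  have h := abs_abs_sub_abs_le_abs_sub (y - (c + 1 / n)) (y - c)
  have e : y - (c + 1 / n) - (y - c) = -(1 / n) := by ring
  rw [e, abs_neg, abs_of_pos (by positivity : (0 : ℝ) < 1 / n), abs_le] at h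
  have h1 := mul_le_mul_of_nonneg_left h.1 hn'.le
  have h2 := mul_le_mul_of_nonneg_left h.2 hn'.le
  have e1 : (n : ℝ) * (1 / n) = 1 := by field_simp
  rw [mul_neg, e1] at h1
  rw [e1] at h2
  unfold ramp
  rw [abs_le]
  constructor <;> linarith

theorem tendsto_ramp (c y : ℝ) :
    Tendsto (fun n => ramp c n y) atTop (𝓝 ((Iic c).indicator 1 y)) := by
  -- At a fixed point the sequence is eventually constant: for y > c, as soon as 1 / n < y - c.
  refine tendsto_const_nhds.congr' ?_
  rcases le_or_gt y c with h | h
  · filter_upwards [eventually_gt_atTop 0] with n hn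
    have hn' : (0 : ℝ) < n := by exact_mod_cast hn
    have hi : (0 : ℝ) < 1 / n := by positivity
    rw [indicator_of_mem (mem_Iic.2 h), ramp, abs_of_nonpos (by linarith), abs_of_nonpos (by linarith)]
    field_simp
    simp
    ring
  · filter_upwards [eventually_gt_atTop 0,
      tendsto_one_div_atTop_nhds_zero_nat.eventually (gt_mem_nhds (sub_pos.2 h))] with n hn hi
    have hn' : (0 : ℝ) < n := by exact_mod_cast hn
    rw [indicator_of_notMem (notMem_Iic.2 h), ramp, abs_of_nonneg (by linarith),
      abs_of_nonneg (by linarith)]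
    field_simp
    ring

/-- A probability measure on the interval is determined by its mean distances to points. -/
theorem eq_of_integral_dist_eq
    (h : ∀ x : unitInterval, ∫ y, dist y x ∂(μ : Measure unitInterval) =
      ∫ y, dist y x ∂(ν : Measure unitInterval)) : μ = ν := by
  refine Subtype.ext (Measure.ext_of_Iic (μ : Measure unitInterval) (ν : Measure unitInterval) fun c => ?_)
  -- The point 1 is treated apart because the knot c + 1 / n of the ramp has to lie in the interval.
  rcases eq_or_lt_of_le (unitInterval.le_one' : c ≤ 1) with rfl | hc
  · have : (Iic 1 : Set unitInterval) = univ := eq_univ_of_forall fun y => y.2.2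
    rw [this, measure_univ, measure_univ]
  have hlim : ∀ m : ProbabilityMeasure unitInterval,
      Tendsto (fun n => ∫ y, ramp c n y ∂(m : Measure unitInterval)) atTop
        (𝓝 ((m : Measure unitInterval).real (Iic c))) := by
    intro m
    have : (m : Measure unitInterval).real (Iic c) =
        ∫ y : unitInterval, (Iic (c : ℝ)).indicator 1 (y : ℝ) ∂(m : Measure unitInterval) := by
      rw [← integral_indicator_one measurableSet_Iic]
      rfl
    rw [this]
    refine tendsto_integral_of_dominated_convergence (fun _ => 1) (fun n => ?_)
      (integrable_const _) (fun n => ?_) ?_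
    · exact (by unfold ramp; fun_prop : Continuous fun y : unitInterval =>
        ramp c n y).aestronglyMeasurable
    · exact Eventually.of_forall fun y => abs_ramp_le c n y
    · exact Eventually.of_forall fun y => tendsto_ramp c y
  -- For large n both knots of the ramp are points of the interval, so its integral is an affine
  -- expression in two mean distances.
  have hev : ∀ᶠ n : ℕ in atTop, ∫ y, ramp c n y ∂(μ : Measure unitInterval) =
      ∫ y, ramp c n y ∂(ν : Measure unitInterval) := by
    filter_upwards [tendsto_one_div_atTop_nhds_zero_nat.eventually
      (gt_mem_nhds (sub_pos.2 (show (c : ℝ) < 1 from hc)))] with n hn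
    have hi : (0 : ℝ) ≤ 1 / n := by positivity
    let d : unitInterval := ⟨c + 1 / n, by linarith [c.2.1], by linarith⟩
    have : ∀ m : ProbabilityMeasure unitInterval, ∫ y, ramp c n y ∂(m : Measure unitInterval) =
        (n : ℝ) / 2 * ((∫ y, dist y d ∂(m : Measure unitInterval)) -
          ∫ y, dist y c ∂(m : Measure unitInterval)) + 1 / 2 := by
      intro m
      have hr : ∀ y : unitInterval,
          ramp c n y = (n : ℝ) / 2 * (dist y d - dist y c) + 1 / 2 := fun y => rfl
      simp only [hr]
      rw [integral_add (integrable_of_continuous (by fun_prop) _) (integrable_const _),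
        integral_const_mul, integral_sub (integrable_of_continuous (by fun_prop) _)
          (integrable_of_continuous (by fun_prop) _)]
      simp
    rw [this, this, h, h]
  have := tendsto_nhds_unique ((hlim μ).congr' hev) (hlim ν)
  rwa [measureReal_def, measureReal_def, ENNReal.toReal_eq_toReal_iff' (measure_ne_top _ _)
    (measure_ne_top _ _)] at this

theorem eq_of_kantorovichDist_eq_zero (h : kantorovichDist μ ν = 0) : μ = ν :=
  eq_of_integral_dist_eq fun x => sub_eq_zero.1 <| abs_eq_zero.1 <| le_antisymm
    (h ▸ le_kantorovichDist (LipschitzWith.dist_left x)) (abs_nonneg _)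

theorem kantorovichDist_diracProb_diracProb (x y : unitInterval) :
    kantorovichDist (diracProb x) (diracProb y) = dist x y := by
  rw [kantorovichDist_diracProb]
  simp [diracProb]

end Kantorovich

/-! ### Convex combinations -/

section ConvexComb

variable {μ ν κ : ProbabilityMeasure unitInterval}

theorem IsConvexComb.eq {κ' : ProbabilityMeasure unitInterval} {t : ℝ}
    (h : IsConvexComb t μ ν κ) (h' : IsConvexComb t μ ν κ') : κ = κ' :=
  Subtype.ext (h.trans h'.symm)

theorem exists_isConvexComb {t : ℝ} (ht : t ∈ Icc (0 : ℝ) 1)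
    (μ ν : ProbabilityMeasure unitInterval) : ∃ κ, IsConvexComb t μ ν κ := by
  refine ⟨⟨ENNReal.ofReal t • (μ : Measure unitInterval) +
    ENNReal.ofReal (1 - t) • (ν : Measure unitInterval), ⟨?_⟩⟩, rfl⟩
  simp only [Measure.coe_add, Measure.coe_smul, Pi.add_apply, Pi.smul_apply, measure_univ,
    smul_eq_mul, mul_one]
  rw [← ENNReal.ofReal_add ht.1 (by linarith [ht.2])]
  simp

theorem IsConvexComb.map {t : ℝ} (h : IsConvexComb t μ ν κ) {f : unitInterval → unitInterval}
    (hf : Measurable f) : IsConvexComb t (μ.map hf.aemeasurable) (ν.map hf.aemeasurable)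
      (κ.map hf.aemeasurable) := by
  simp only [IsConvexComb, ProbabilityMeasure.toMeasure_map] at h ⊢
  rw [h, Measure.map_add _ _ hf, Measure.map_smul, Measure.map_smul]

/-- Dirac masses are extreme points of the set of probability measures. -/
theorem IsConvexComb.eq_diracProb {t : ℝ} (ht0 : 0 < t) {x : unitInterval}
    (h : IsConvexComb t μ ν (diracProb x)) : μ = diracProb x := by
  have h0 : (μ : Measure unitInterval) {x}ᶜ = 0 := by
    have := congrArg (fun m : Measure unitInterval => m {x}ᶜ) h
    simp only [diracProb, ProbabilityMeasure.coe_mk, Measure.coe_add, Measure.coe_smul,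
      Pi.add_apply, Pi.smul_apply, smul_eq_mul] at this
    rw [Measure.dirac_apply' _ (measurableSet_singleton x).compl, indicator_of_notMem (by simp)] at this
    have := (add_eq_zero.1 this.symm).1
    exact (mul_eq_zero.1 this).resolve_left (by simpa using ht0)
  have hae : ∀ᵐ y ∂(μ : Measure unitInterval), y = x := by
    rw [ae_iff]
    exact h0
  refine eq_of_integral_dist_eq fun z => ?_
  have : (fun y => dist y z) =ᵐ[(μ : Measure unitInterval)] fun _ => dist x z := by
    filter_upwards [hae] with y hy
    rw [hy]
  rw [integral_congr_ae this]
  simp [diracProb]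

theorem IsConvexComb.symm {t : ℝ} (h : IsConvexComb t μ ν κ) : IsConvexComb (1 - t) ν μ κ := by
  rw [IsConvexComb, sub_sub_cancel, add_comm]
  exact h

/-- A probability measure that is not a Dirac mass is a proper convex combination of two
different probability measures. -/
theorem exists_isConvexComb_of_ne_diracProb (h : ∀ x, κ ≠ diracProb x) :
    ∃ t ∈ Ioo (0 : ℝ) 1, ∃ μ ν, μ ≠ ν ∧ IsConvexComb t μ ν κ := by
  let m : Measure unitInterval := κ
  have hint : Integrable (fun y : unitInterval => (y : ℝ)) m :=
    integrable_of_continuous (by fun_prop) _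
  have hE : ∫ y, (y : ℝ) ∂m ∈ Icc (0 : ℝ) 1 :=
    ⟨integral_nonneg fun y => y.2.1,
      (integral_mono hint (integrable_const (1 : ℝ)) fun y => y.2.2).trans (by simp)⟩
  -- The measure is cut at its mean c. If [0, c] or its complement were null, y - c would have
  -- constant sign almost everywhere and integral zero, which would force the Dirac mass at c.
  let c : unitInterval := ⟨∫ y, (y : ℝ) ∂m, hE⟩
  have hzero : ∫ y : unitInterval, ((y : ℝ) - c) ∂m = 0 := by
    rw [integral_sub hint (integrable_const _)]
    simp [c]
  have hdirac : ¬ ∀ᵐ y ∂m, y = c := by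
    intro hae
    refine h c (eq_of_integral_dist_eq fun z => ?_)
    have : (fun y => dist y z) =ᵐ[m] fun _ => dist c z := by
      filter_upwards [hae] with y hy
      rw [hy]
    rw [integral_congr_ae this]
    simp [diracProb, m]
  have hA : m (Iic c) ≠ 0 := by
    intro h0
    have hlt : ∀ᵐ y ∂m, c < y := by
      rw [ae_iff]
      simp only [not_lt]
      exact h0
    refine hdirac ?_
    have := (integral_eq_zero_iff_of_nonneg_ae (f := fun y : unitInterval => (y : ℝ) - c)
      (by filter_upwards [hlt] with y hy; exact sub_nonneg.2 hy.le)
      (hint.sub (integrable_const _))).1 hzero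
    filter_upwards [this] with y hy
    exact Subtype.ext (sub_eq_zero.1 hy)
  have hB : m (Iic c)ᶜ ≠ 0 := by
    intro h0
    have hle : ∀ᵐ y ∂m, y ≤ c := by
      rw [ae_iff]
      exact h0
    refine hdirac ?_
    have hzero' : ∫ y : unitInterval, ((c : ℝ) - y) ∂m = 0 := by
      rw [← neg_eq_zero, ← integral_neg, ← hzero]
      simp
    have := (integral_eq_zero_iff_of_nonneg_ae (f := fun y : unitInterval => (c : ℝ) - y)
      (by filter_upwards [hle] with y hy; exact sub_nonneg.2 hy)
      ((integrable_const _).sub hint)).1 hzero'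
    filter_upwards [this] with y hy
    exact Subtype.ext (sub_eq_zero.1 hy).symm
  have hsum : m.real (Iic c) + m.real (Iic c)ᶜ = 1 := probReal_add_probReal_compl measurableSet_Iic
  have hApos : 0 < m.real (Iic c) := ENNReal.toReal_pos hA (measure_ne_top _ _)
  have hBpos : 0 < m.real (Iic c)ᶜ := ENNReal.toReal_pos hB (measure_ne_top _ _)
  refine ⟨m.real (Iic c), ⟨hApos, by linarith⟩,
    ⟨ProbabilityTheory.cond m (Iic c), ProbabilityTheory.cond_isProbabilityMeasure hA⟩,
    ⟨ProbabilityTheory.cond m (Iic c)ᶜ, ProbabilityTheory.cond_isProbabilityMeasure hB⟩, ?_, ?_⟩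
  · intro heq
    have := congrArg (fun p : ProbabilityMeasure unitInterval =>
      (p : Measure unitInterval) (Iic c)) heq
    simp only [ProbabilityMeasure.coe_mk] at this
    rw [ProbabilityTheory.cond_apply measurableSet_Iic, inter_self,
      ENNReal.inv_mul_cancel hA (measure_ne_top _ _),
      ProbabilityTheory.cond_apply measurableSet_Iic.compl, compl_inter_self] at this
    simp at this
  · change m = ENNReal.ofReal (m.real (Iic c)) • ProbabilityTheory.cond m (Iic c) +
      ENNReal.ofReal (1 - m.real (Iic c)) • ProbabilityTheory.cond m (Iic c)ᶜ
    rw [show 1 - m.real (Iic c) = m.real (Iic c)ᶜ by linarith, measureReal_def,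
      measureReal_def, ENNReal.ofReal_toReal (measure_ne_top _ _),
      ENNReal.ofReal_toReal (measure_ne_top _ _)]
    refine Measure.ext fun s hs => ?_
    simp only [Measure.coe_add, Measure.coe_smul, Pi.add_apply, Pi.smul_apply, smul_eq_mul]
    rw [mul_comm, mul_comm (m (Iic c)ᶜ), add_comm, add_comm]
    exact (ProbabilityTheory.cond_add_cond_compl_eq measurableSet_Iic m).symm

end ConvexComb

/-! ### Affine isometries of the set of all probability measures -/

/-- The image of a probability measure under the reflection of the interval. -/
def reflect (μ : ProbabilityMeasure unitInterval) : ProbabilityMeasure unitInterval :=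
  μ.map measurable_symm.aemeasurable

theorem integral_reflect (μ : ProbabilityMeasure unitInterval) {f : unitInterval → ℝ}
    (hf : Continuous f) : ∫ x, f x ∂(reflect μ : Measure unitInterval) =
      ∫ x, f (σ x) ∂(μ : Measure unitInterval) := by
  rw [reflect, ProbabilityMeasure.toMeasure_map]
  exact integral_map measurable_symm.aemeasurable hf.aestronglyMeasurable

theorem reflect_reflect (μ : ProbabilityMeasure unitInterval) : reflect (reflect μ) = μ := by
  refine Subtype.ext ?_
  change Measure.map σ (Measure.map σ (μ : Measure unitInterval)) = μ
  rw [Measure.map_map measurable_symm measurable_symm, symm_involutive.comp_self, Measure.map_id]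

theorem kantorovichDist_reflect_le (μ ν : ProbabilityMeasure unitInterval) :
    kantorovichDist (reflect μ) (reflect ν) ≤ kantorovichDist μ ν := by
  refine kantorovichDist_le fun f hf => ?_
  rw [integral_reflect _ hf.continuous, integral_reflect _ hf.continuous]
  exact le_kantorovichDist (f := fun x => f (σ x)) (LipschitzWith.mk_one fun x y =>
    dist_symm_symm x y ▸ by simpa using hf.dist_le_mul (σ x) (σ y))

theorem isAffineIsometry_reflect :
    IsAffineIsometry (univ : Set (ProbabilityMeasure unitInterval))
      (fun μ => ⟨reflect μ.1, mem_univ _⟩) where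
  surjective μ := ⟨⟨reflect μ.1, mem_univ _⟩, Subtype.ext (reflect_reflect _)⟩
  isometry μ ν := by
    refine le_antisymm (kantorovichDist_reflect_le _ _) ?_
    have := kantorovichDist_reflect_le (reflect μ.1) (reflect ν.1)
    rwa [reflect_reflect, reflect_reflect] at this
  affine t _ μ ν κ h := h.map measurable_symm

theorem IsAffineIsometry.injective {K : Set (ProbabilityMeasure unitInterval)} {Φ : K → K}
    (hΦ : IsAffineIsometry K Φ) : Function.Injective Φ := fun μ ν h => by
  refine Subtype.ext (eq_of_kantorovichDist_eq_zero ?_)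
  rw [← hΦ.isometry, h, kantorovichDist_self]

/-- Affine isometries preserve the set of Dirac masses. -/
theorem IsAffineIsometry.exists_eq_diracProb
    {Φ : ↥(univ : Set (ProbabilityMeasure unitInterval)) →
      ↥(univ : Set (ProbabilityMeasure unitInterval))} (hΦ : IsAffineIsometry univ Φ)
    (x : unitInterval) : ∃ y, (Φ ⟨diracProb x, mem_univ _⟩).1 = diracProb y := by
  by_contra! hne
  obtain ⟨t, ht, μ, ν, hμν, hc⟩ := exists_isConvexComb_of_ne_diracProb hne
  obtain ⟨⟨μ', _⟩, hμ⟩ := hΦ.surjective ⟨μ, mem_univ _⟩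
  obtain ⟨⟨ν', _⟩, hν⟩ := hΦ.surjective ⟨ν, mem_univ _⟩
  -- Affinity transports combinations forward only. So the preimages are combined first, and
  -- injectivity of Φ identifies the result with the Dirac mass, whose extremality gives μ' = ν'.
  obtain ⟨κ, hκ⟩ := exists_isConvexComb (Ioo_subset_Icc_self ht) μ' ν'
  have h1 := hΦ.affine t (Ioo_subset_Icc_self ht) ⟨μ', mem_univ _⟩ ⟨ν', mem_univ _⟩
    ⟨κ, mem_univ _⟩ hκ
  rw [hμ, hν] at h1
  have h2 := congrArg Subtype.val (hΦ.injective (Subtype.ext (h1.eq hc)))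
  dsimp only at h2
  subst h2
  have e1 := hκ.eq_diracProb ht.1
  have e2 := hκ.symm.eq_diracProb (sub_pos.2 ht.2)
  subst e1
  subst e2
  exact hμν (congrArg Subtype.val (hμ.symm.trans hν))

/-- The only affine isometries are the identity and the reflection. -/
theorem IsAffineIsometry.eq_self_or_eq_reflect
    {Φ : ↥(univ : Set (ProbabilityMeasure unitInterval)) →
      ↥(univ : Set (ProbabilityMeasure unitInterval))} (hΦ : IsAffineIsometry univ Φ)
    (μ : ProbabilityMeasure unitInterval) :
    (Φ ⟨μ, mem_univ _⟩).1 = μ ∨ (Φ ⟨μ, mem_univ _⟩).1 = reflect μ := by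
  -- Φ moves Dirac masses by a distance preserving map g, and the mean distance of Φ μ to g x equals
  -- that of μ to x.
  choose g hg using hΦ.exists_eq_diracProb
  have hgd : ∀ x y, dist (g x) (g y) = dist x y := fun x y => by
    rw [← kantorovichDist_diracProb_diracProb, ← hg, ← hg, hΦ.isometry,
      kantorovichDist_diracProb_diracProb]
  have hmean : ∀ x, ∫ y, dist y (g x) ∂((Φ ⟨μ, mem_univ _⟩).1 : Measure unitInterval) =
      ∫ y, dist y x ∂(μ : Measure unitInterval) := fun x => by
    rw [← kantorovichDist_diracProb, ← hg, hΦ.isometry, kantorovichDist_diracProb]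
  refine (eq_id_or_eq_symm_of_dist_eq hgd).imp (fun h => eq_of_integral_dist_eq fun x => ?_)
    fun h => eq_of_integral_dist_eq fun x => ?_
  · rw [← hmean, h]
  · have := hmean (σ x)
    rw [h, symm_symm] at this
    rw [this, integral_reflect _ (by fun_prop)]
    refine integral_congr_ae (Eventually.of_forall fun y => ?_)
    dsimp only
    rw [← dist_symm_symm, symm_symm]

theorem mem_fixSet_univ_iff {μ : ProbabilityMeasure unitInterval} :
    μ ∈ fixSet (univ : Set (ProbabilityMeasure unitInterval)) ↔ reflect μ = μ := by
  constructor
  · rintro ⟨_, h⟩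
    exact congrArg Subtype.val (h _ isAffineIsometry_reflect)
  · intro h
    refine ⟨mem_univ _, fun Φ hΦ => Subtype.ext ?_⟩
    exact (hΦ.eq_self_or_eq_reflect μ).elim id fun h' => h'.trans h

/-! ### Unfolding of measures -/

/-- The image of a probability measure under the inverse of the tent map. -/
def unfoldProb (μ : ProbabilityMeasure unitInterval) : ProbabilityMeasure unitInterval :=
  ⟨(2⁻¹ : ENNReal) • Measure.map half μ + (2⁻¹ : ENNReal) • Measure.map (fun x => σ (half x)) μ, by
    have h1 : IsProbabilityMeasure (Measure.map half (μ : Measure unitInterval)) :=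
      Measure.isProbabilityMeasure_map continuous_half.aemeasurable
    have h2 : IsProbabilityMeasure (Measure.map (fun x => σ (half x)) (μ : Measure unitInterval)) :=
      Measure.isProbabilityMeasure_map (continuous_symm.comp continuous_half).aemeasurable
    exact ⟨by simp [ENNReal.inv_two_add_inv_two]⟩⟩

theorem coe_unfoldProb (μ : ProbabilityMeasure unitInterval) :
    (unfoldProb μ : Measure unitInterval) = (2⁻¹ : ENNReal) • Measure.map half μ +
      (2⁻¹ : ENNReal) • Measure.map (fun x => σ (half x)) μ := rfl

theorem measurable_symm_half : Measurable fun x => σ (half x) :=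
  measurable_symm.comp continuous_half.measurable

/-- Both branches `half` and `σ ∘ half` are sections of `fold`. -/
theorem map_fold_unfoldProb (μ : ProbabilityMeasure unitInterval) :
    (unfoldProb μ).map continuous_fold.measurable.aemeasurable = μ := by
  refine Subtype.ext ?_
  change Measure.map fold (unfoldProb μ : Measure unitInterval) = μ
  have e1 : fold ∘ half = id := funext fold_half
  have e2 : (fold ∘ fun x => σ (half x)) = id := funext fun x => by simp [fold_symm, fold_half]
  rw [coe_unfoldProb, Measure.map_add _ _ continuous_fold.measurable, Measure.map_smul,
    Measure.map_smul, Measure.map_map continuous_fold.measurable continuous_half.measurable,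
    Measure.map_map continuous_fold.measurable measurable_symm_half, e1, e2, Measure.map_id,
    ← add_smul, ENNReal.inv_two_add_inv_two, one_smul]

theorem unfoldProb_injective : Function.Injective unfoldProb := fun μ ν h => by
  rw [← map_fold_unfoldProb μ, ← map_fold_unfoldProb ν]
  congr 1

theorem reflect_unfoldProb (μ : ProbabilityMeasure unitInterval) : reflect (unfoldProb μ) = unfoldProb μ := by
  refine Subtype.ext ?_
  change Measure.map σ (unfoldProb μ : Measure unitInterval) = unfoldProb μ
  have e1 : (σ ∘ fun x => σ (half x)) = half := funext fun x => by simp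
  rw [coe_unfoldProb, Measure.map_add _ _ measurable_symm, Measure.map_smul,
    Measure.map_smul, Measure.map_map measurable_symm continuous_half.measurable,
    Measure.map_map measurable_symm measurable_symm_half, e1, add_comm]
  rfl

theorem integral_unfoldProb (μ : ProbabilityMeasure unitInterval) {f : unitInterval → ℝ}
    (hf : Continuous f) : ∫ x, f x ∂(unfoldProb μ : Measure unitInterval) =
      2⁻¹ * ∫ x, (f (half x) + f (σ (half x))) ∂(μ : Measure unitInterval) := by
  have h1 : Continuous fun x => f (half x) := hf.comp continuous_half
  have h2 : Continuous fun x => f (σ (half x)) := hf.comp (continuous_symm.comp continuous_half)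
  have i1 : Integrable f (Measure.map half (μ : Measure unitInterval)) :=
    integrable_of_continuous hf _
  have i2 : Integrable f (Measure.map (fun x => σ (half x)) (μ : Measure unitInterval)) :=
    integrable_of_continuous hf _
  rw [coe_unfoldProb, integral_add_measure (i1.smul_measure (by simp)) (i2.smul_measure (by simp)),
    integral_smul_measure, integral_smul_measure,
    integral_map continuous_half.aemeasurable hf.aestronglyMeasurable,
    integral_map measurable_symm_half.aemeasurable hf.aestronglyMeasurable,
    integral_add (integrable_of_continuous h1 _) (integrable_of_continuous h2 _), mul_add]
  simp

/-- The points `half (fold x)` and `σ (half (fold x))` are x and σ x in some order, so unfolding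
after folding averages μ with its reflection. -/
theorem unfoldProb_map_fold {μ : ProbabilityMeasure unitInterval} (h : reflect μ = μ) :
    unfoldProb (μ.map continuous_fold.measurable.aemeasurable) = μ := by
  refine eq_of_integral_dist_eq fun z => ?_
  have hc : Continuous fun x => dist (half x) z + dist (σ (half x)) z :=
    (continuous_half.dist continuous_const).add
      ((continuous_symm.comp continuous_half).dist continuous_const)
  rw [integral_unfoldProb _ (by fun_prop), ProbabilityMeasure.toMeasure_map,
    integral_map continuous_fold.aemeasurable hc.aestronglyMeasurable]
  have hpt : ∀ x, dist (half (fold x)) z + dist (σ (half (fold x))) z =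
      dist x z + dist (σ x) z := by
    intro x
    rcases half_fold x with h | h <;> rw [h]
    rw [symm_symm, add_comm]
  simp only [hpt]
  rw [integral_add (integrable_of_continuous (by fun_prop) _)
    (integrable_of_continuous (by fun_prop) _),
    ← integral_reflect μ (f := fun x => dist x z) (by fun_prop), h]
  ring

theorem fixSet_univ_eq_range_unfoldProb :
    fixSet (univ : Set (ProbabilityMeasure unitInterval)) = range unfoldProb := by
  ext μ
  rw [mem_fixSet_univ_iff]
  exact ⟨fun h => ⟨_, unfoldProb_map_fold h⟩, by rintro ⟨ν, rfl⟩; exact reflect_unfoldProb ν⟩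

/-- Test functions pass both ways: f gives f ∘ half + f ∘ σ ∘ half, a sum of two 1/2-Lipschitz
functions, and in return 2⁻¹ · (f ∘ fold) is 1-Lipschitz. Equality is needed so that conjugation
preserves isometries. -/
theorem kantorovichDist_unfoldProb (μ ν : ProbabilityMeasure unitInterval) :
    kantorovichDist (unfoldProb μ) (unfoldProb ν) = 2⁻¹ * kantorovichDist μ ν := by
  refine le_antisymm (kantorovichDist_le fun f hf => ?_) ?_
  · rw [integral_unfoldProb _ hf.continuous, integral_unfoldProb _ hf.continuous, ← mul_sub, abs_mul,
      abs_of_pos (by norm_num : (0 : ℝ) < 2⁻¹)]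
    refine mul_le_mul_of_nonneg_left (le_kantorovichDist (f := fun x => f (half x) +
      f (σ (half x))) (LipschitzWith.mk_one fun x y => ?_)) (by norm_num)
    have h1 := hf.dist_le_mul (half x) (half y)
    have h2 := hf.dist_le_mul (σ (half x)) (σ (half y))
    rw [dist_symm_symm] at h2
    simp only [dist_half, NNReal.coe_one, one_mul] at h1 h2
    exact (dist_add_add_le _ _ _ _).trans (by linarith)
  · rw [← le_div_iff₀' (by norm_num)]
    refine kantorovichDist_le fun f hf => ?_
    have hl : LipschitzWith 1 fun x => 2⁻¹ * f (fold x) := LipschitzWith.mk_one fun x y => by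
      have h1 := hf.dist_le_mul (fold x) (fold y)
      rw [NNReal.coe_one, one_mul] at h1
      rw [Real.dist_eq, ← mul_sub, abs_mul, abs_of_pos (by norm_num : (0 : ℝ) < 2⁻¹),
        ← Real.dist_eq]
      linarith [dist_fold_le x y]
    have hle := le_kantorovichDist (μ := unfoldProb μ) (ν := unfoldProb ν) hl
    have hi : ∀ m : ProbabilityMeasure unitInterval,
        ∫ x, 2⁻¹ * f (fold x) ∂(unfoldProb m : Measure unitInterval) =
          2⁻¹ * ∫ x, f x ∂(m : Measure unitInterval) := by
      intro m
      rw [integral_unfoldProb m hl.continuous]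
      simp only [fold_symm, fold_half]
      congr 2
      funext x
      ring
    rw [hi, hi, ← mul_sub, abs_mul, abs_of_pos (by norm_num : (0 : ℝ) < 2⁻¹)] at hle
    rwa [le_div_iff₀' (by norm_num)]

theorem isConvexComb_unfoldProb_iff {t : ℝ} {μ ν κ : ProbabilityMeasure unitInterval} :
    IsConvexComb t (unfoldProb μ) (unfoldProb ν) (unfoldProb κ) ↔ IsConvexComb t μ ν κ := by
  constructor
  · intro h
    have := h.map continuous_fold.measurable
    rwa [map_fold_unfoldProb, map_fold_unfoldProb, map_fold_unfoldProb] at this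
  · intro h
    have h1 := h.map continuous_half.measurable
    have h2 := h.map measurable_symm_half
    simp only [IsConvexComb, ProbabilityMeasure.toMeasure_map] at h1 h2
    rw [IsConvexComb, coe_unfoldProb, h1, h2, coe_unfoldProb, coe_unfoldProb]
    simp only [smul_add, smul_comm (2⁻¹ : ENNReal)]
    abel

theorem unfoldProb_volume :
    unfoldProb ⟨(volume : Measure unitInterval), inferInstance⟩ =
      ⟨(volume : Measure unitInterval), inferInstance⟩ := by
  refine Subtype.ext (Measure.ext_of_Iic (unfoldProb _ : Measure unitInterval) volume fun a => ?_)
  change ((2⁻¹ : ENNReal) • Measure.map half (volume : Measure unitInterval) +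
    (2⁻¹ : ENNReal) • Measure.map (fun x => σ (half x)) volume) (Iic a) = _
  simp only [Measure.coe_add, Measure.coe_smul, Pi.add_apply,
    Pi.smul_apply, smul_eq_mul]
  rw [Measure.map_apply continuous_half.measurable measurableSet_Iic,
    Measure.map_apply measurable_symm_half measurableSet_Iic, volume_Iic]
  -- Here u and v are the volumes of the preimages of [0, a] under the two branches.
  have key : ∀ u v : ℝ, 0 ≤ u → 0 ≤ v → u + v = 2 * a →
      (2⁻¹ : ENNReal) * ENNReal.ofReal u + 2⁻¹ * ENNReal.ofReal v = ENNReal.ofReal a := by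
    intro u v hu hv huv
    rw [← mul_add, ← ENNReal.ofReal_add hu hv, huv, ENNReal.ofReal_mul (by norm_num),
      ENNReal.ofReal_ofNat, ← mul_assoc, ENNReal.inv_mul_cancel (by norm_num) (by norm_num),
      one_mul]
  rcases le_total (a : ℝ) (1 / 2) with ha | ha
  · let b : unitInterval := ⟨2 * a, by linarith [a.2.1], by linarith⟩
    have e1 : half ⁻¹' Iic a = Iic b := by
      ext x
      change (x : ℝ) / 2 ≤ a ↔ (x : ℝ) ≤ 2 * a
      constructor <;> intro h <;> linarith
    -- The second branch takes values in [1/2, 1], so it meets [0, a] at most in the image of the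
    -- point 1.
    have e2 : volume ((fun x => σ (half x)) ⁻¹' Iic a) = 0 := by
      refine measure_mono_null (fun x hx => ?_) (measure_singleton (1 : unitInterval))
      change 1 - (x : ℝ) / 2 ≤ a at hx
      exact Subtype.ext (le_antisymm x.2.2 (by linarith : (1 : ℝ) ≤ x))
    rw [e1, e2, volume_Iic, ← ENNReal.ofReal_zero]
    exact key _ _ b.2.1 le_rfl (add_zero _)
  · let b : unitInterval := ⟨2 - 2 * a, by linarith [a.2.2], by linarith⟩
    have e1 : half ⁻¹' Iic a = univ := by
      refine eq_univ_of_forall fun x => ?_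
      change (x : ℝ) / 2 ≤ a
      linarith [x.2.2]
    have e2 : (fun x => σ (half x)) ⁻¹' Iic a = Ici b := by
      ext x
      change 1 - (x : ℝ) / 2 ≤ a ↔ 2 - 2 * (a : ℝ) ≤ x
      constructor <;> intro h <;> linarith
    rw [e1, e2, volume_Ici, measure_univ, ← ENNReal.ofReal_one]
    refine key _ _ zero_le_one (by linarith [b.2.2]) ?_
    change 1 + (1 - (2 - 2 * (a : ℝ))) = 2 * a
    ring

/-! ### Iterated fixed point sets -/

/-- Conjugation by `unfoldProb` identifies the affine isometries of `K` with those of its image. -/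
theorem fixSet_image_unfoldProb (K : Set (ProbabilityMeasure unitInterval)) :
    fixSet (unfoldProb '' K) = unfoldProb '' fixSet K := by
  let e : K ≃ unfoldProb '' K := Equiv.Set.image unfoldProb K unfoldProb_injective
  have he : ∀ μ : K, (e μ).1 = unfoldProb μ.1 := fun μ => rfl
  have he' : ∀ μ : unfoldProb '' K, unfoldProb (e.symm μ).1 = μ.1 := fun μ => by
    rw [← he, e.apply_symm_apply]
  ext μ
  constructor
  · rintro ⟨⟨ν, hν, rfl⟩, h⟩
    refine ⟨ν, ⟨hν, fun Φ hΦ => ?_⟩, rfl⟩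
    have := h (fun m => e (Φ (e.symm m)))
      { surjective := e.surjective.comp (hΦ.surjective.comp e.symm.surjective)
        isometry := fun m n => by
          rw [he, he, kantorovichDist_unfoldProb, hΦ.isometry, ← kantorovichDist_unfoldProb, he', he']
        affine := fun t ht m n k hk => by
          rw [he, he, he, isConvexComb_unfoldProb_iff]
          refine hΦ.affine t ht _ _ _ ?_
          rwa [← isConvexComb_unfoldProb_iff, he', he', he'] }
    have hs : (⟨unfoldProb ν, mem_image_of_mem _ hν⟩ : unfoldProb '' K) = e ⟨ν, hν⟩ := rfl
    rw [hs, e.symm_apply_apply] at this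
    exact e.injective this
  · rintro ⟨ν, ⟨hν, h⟩, rfl⟩
    refine ⟨mem_image_of_mem _ hν, fun Φ hΦ => ?_⟩
    have := h (fun m => e.symm (Φ (e m)))
      { surjective := e.symm.surjective.comp (hΦ.surjective.comp e.surjective)
        isometry := fun m n => by
          have h2 := hΦ.isometry (e m) (e n)
          rw [← he', ← he' (Φ (e n)), he, he, kantorovichDist_unfoldProb,
            kantorovichDist_unfoldProb] at h2
          exact mul_left_cancel₀ (by norm_num) h2
        affine := fun t ht m n k hk => by
          rw [← isConvexComb_unfoldProb_iff, he', he', he']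
          exact hΦ.affine t ht _ _ _ (isConvexComb_unfoldProb_iff.2 hk) }
    exact (e.symm_apply_eq).1 this

theorem iterate_fixSet_univ (n : ℕ) :
    fixSet^[n] (univ : Set (ProbabilityMeasure unitInterval)) = range unfoldProb^[n] := by
  induction n with
  | zero => simp
  | succ n ih =>
    -- The outermost unfolding is moved across `fixSet` until only Fix(Prob), the range of one
    -- unfolding, remains.
    have hcomm : ∀ n : ℕ, fixSet (range unfoldProb^[n]) = range unfoldProb^[n + 1] := by
      intro n
      induction n with
      | zero => simp [fixSet_univ_eq_range_unfoldProb]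
      | succ n ihn =>
        rw [Function.iterate_succ', range_comp, fixSet_image_unfoldProb, ihn, ← range_comp,
          ← Function.iterate_succ']
    rw [Function.iterate_succ_apply', ih, hcomm]

theorem kantorovichDist_iterate_unfoldProb (n : ℕ) (μ ν : ProbabilityMeasure unitInterval) :
    kantorovichDist (unfoldProb^[n] μ) (unfoldProb^[n] ν) = 2⁻¹ ^ n * kantorovichDist μ ν := by
  induction n with
  | zero => simp
  | succ n ih =>
    rw [Function.iterate_succ_apply', Function.iterate_succ_apply', kantorovichDist_unfoldProb, ih,
      pow_succ']
    ring

theorem deltaSet_unitInterval : deltaSet unitInterval =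
    {(⟨(volume : Measure unitInterval), inferInstance⟩ : ProbabilityMeasure unitInterval)} := by
  have hfix := fun n => Function.iterate_fixed unfoldProb_volume n
  set L : ProbabilityMeasure unitInterval := ⟨(volume : Measure unitInterval), inferInstance⟩
  refine Subset.antisymm (fun μ hμ => ?_) ?_
  -- Both μ and L lie in the range of the n-th iterate, which contracts distances by 2⁻ⁿ.
  · have hle : ∀ n : ℕ, kantorovichDist μ L ≤ 2⁻¹ ^ n * 2 := by
      intro n
      have hn := mem_iInter.1 hμ n
      rw [iterate_fixSet_univ] at hn
      obtain ⟨ν, rfl⟩ := hn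
      conv_lhs => rw [← hfix n]
      rw [kantorovichDist_iterate_unfoldProb]
      exact mul_le_mul_of_nonneg_left
        (kantorovichDist_le fun f hf => abs_integral_sub_integral_le_two hf) (by positivity)
    have hlim : Tendsto (fun n : ℕ => (2⁻¹ : ℝ) ^ n * 2) atTop (𝓝 0) := by
      simpa using (tendsto_pow_atTop_nhds_zero_of_lt_one (r := (2⁻¹ : ℝ)) (by norm_num)
        (by norm_num)).mul_const 2
    exact eq_of_kantorovichDist_eq_zero (le_antisymm
      (ge_of_tendsto' hlim hle) ((abs_nonneg _).trans
        (le_kantorovichDist (LipschitzWith.const' 0))))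
  · rintro _ rfl
    refine mem_iInter.2 fun n => ?_
    rw [iterate_fixSet_univ]
    exact ⟨L, hfix n⟩

end

theorem mainTheorem8 :
    QuasiNilpotent unitInterval ∧
    deltaSet unitInterval =
      {(⟨(volume : Measure unitInterval), inferInstance⟩ : ProbabilityMeasure unitInterval)} :=
  ⟨quasiNilpotent_unitInterval, deltaSet_unitInterval⟩
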